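/- Let $(B,g_B)$ and $(F,g_F)$ be smooth pseudo-Riemannian manifolds (without boundary, of arbitrary signature) of dimensions $m\ge 2$ and $k\ge 0$, with scalar curvatures $S_B$ and $S_F$ (so $S_F=0$ if $k=0$). Let $\mu\in\mathbb R$, let $\psi\in C^\infty(B)$ be positive, and let $S$ be the scalar curvature of the pseudo-Riemannian metric $g=\psi^{2\mu}g_B+\psi^2 g_F$ on $B\times F$. Let $\Delta_B=\nabla^i\nabla_i$ be the Laplace-Beltrami operator of $g_B$, let $\nabla^B\psi$ be the $g_B$-gradient of $\psi$, and put $|\nabla^B\psi|_B^2=g_B(\nabla^B\psi,\nabla^B\psi)$. (Sign conventions: $R(X,Y)Z=\nabla_X\nabla_YZ-\nabla_Y\nabla_XZ-\nabla_{[X,Y]}Z$, and round spheres have positive scalar curvature.) (i) Suppose $\mu\neq-\frac{k}{m-1}$ and $(m,k)\neq(2,0)$. Put $$\eta=\{[k+(m-1)\mu]+(1-\mu)\}k+(m-2)\mu[k+(m-1)\mu],\qquad \alpha=\frac{2[k+(m-1)\mu]}{\eta},\qquad \beta=2\alpha[k+(m-1)\mu].$$ Then $\eta=(m-1)(m-2)\mu^2+2(m-2)k\mu+k(k+1)>0$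 and $\beta>0$; there is a positive $u\in C^\infty(B)$ with $\psi=u^\alpha$; and every positive function $u$ on $B$ with $\psi=u^\alpha$ satisfies $$-\beta\,\Delta_B u+S_B\,u=S\,u^{2\mu\alpha+1}-S_F\,u^{2(\mu-1)\alpha+1}\quad\text{on } B\times F.$$ (ii) Suppose $\mu=-\frac{k}{m-1}$. Then on $B\times F$ $$-\left[-k^2\,\frac{m-2}{m-1}+k(k+1)\right]\frac{|\nabla^B\psi|_B^2}{\psi^2}=\psi^{-2\frac{k}{m-1}}\,S-S_B-S_F\,\psi^{-2\left(\frac{k}{m-1}+1\right)}.$$ -/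

import Mathlib

set_option maxSynthPendingDepth 3

open scoped Manifold ContDiff Topology Bundle

noncomputable section

/-! ### Curvature and Laplacian of a metric written in coordinates

`G : E → E →L[ℝ] E →L[ℝ] ℝ` is a field of bilinear forms on a finite-dimensional real vector
space `E` (the metric read in a chart); everything is evaluated at a point `y` near which `G` is
smooth, symmetric and nondegenerate. -/

namespace MetricInCoordinates

variable {E : Type*} [NormedAddCommGroup E] [NormedSpace ℝ E]

/-- The index-raising isomorphism `E* → E` of the bilinear form `G y`: the inverse of
`v ↦ G y v ·`. -/
def sharp (G : E → E →L[ℝ] E →L[ℝ] ℝ) (y : E) : (E →L[ℝ] ℝ) →L[ℝ] E :=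
  (G y).inverse

/-- The Christoffel symbols of the first kind,
`(u, v, w) ↦ (1/2) (∂_u G(v, w) + ∂_v G(u, w) - ∂_w G(u, v))`. -/
def christoffelFirst (G : E → E →L[ℝ] E →L[ℝ] ℝ) (y : E) : E →L[ℝ] E →L[ℝ] E →L[ℝ] ℝ :=
  (1 / 2 : ℝ) • (fderiv ℝ G y + (fderiv ℝ G y).flip -
    (ContinuousLinearMap.flipₗᵢ ℝ E E ℝ : (E →L[ℝ] E →L[ℝ] ℝ) →L[ℝ] (E →L[ℝ] E →L[ℝ] ℝ)).comp
      (fderiv ℝ G y).flip)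

theorem christoffelFirst_apply (G : E → E →L[ℝ] E →L[ℝ] ℝ) (y u v w : E) :
    christoffelFirst G y u v w =
      (1 / 2) * (fderiv ℝ G y u v w + fderiv ℝ G y v u w - fderiv ℝ G y w u v) := by
  simp [christoffelFirst]

/-- The Christoffel symbols `Γ(u, v)` of the Levi-Civita connection: with `u`, `v` constant vector
fields in the chart, `Γ(u, v) = ∇_u v`. -/
def christoffel (G : E → E →L[ℝ] E →L[ℝ] ℝ) (y : E) : E →L[ℝ] E →L[ℝ] E :=
  (ContinuousLinearMap.compL ℝ E (E →L[ℝ] ℝ) E (sharp G y)).comp (christoffelFirst G y)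

theorem christoffel_apply (G : E → E →L[ℝ] E →L[ℝ] ℝ) (y u v : E) :
    christoffel G y u v = sharp G y (christoffelFirst G y u v) := rfl

/-- The Riemann curvature tensor `R(u, v) w = ∇_u ∇_v w - ∇_v ∇_u w - ∇_[u,v] w`, computed with
`u`, `v`, `w` constant vector fields in the chart. -/
def riemann (G : E → E →L[ℝ] E →L[ℝ] ℝ) (y u v w : E) : E :=
  fderiv ℝ (christoffel G) y u v w - fderiv ℝ (christoffel G) y v u w
    + christoffel G y u (christoffel G y v w) - christoffel G y v (christoffel G y u w)

/-- The endomorphism `u ↦ R(u, w) v`. -/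
def riemannEnd (G : E → E →L[ℝ] E →L[ℝ] ℝ) (y v w : E) : E →ₗ[ℝ] E where
  toFun u := riemann G y u w v
  map_add' a b := by simp only [riemann, map_add, add_apply]; abel
  map_smul' c a := by
    simp only [riemann, map_smul, smul_apply, RingHom.id_apply, smul_sub, smul_add]

/-- The Ricci tensor `Ric(v, w) = tr (u ↦ R(u, w) v)`. -/
def ricci (G : E → E →L[ℝ] E →L[ℝ] ℝ) (y : E) : E →ₗ[ℝ] E →ₗ[ℝ] ℝ :=
  LinearMap.mk₂ ℝ (fun v w => LinearMap.trace ℝ E (riemannEnd G y v w))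
    (fun a b w => by
      rw [← map_add]; congr 1; ext u; simp [riemannEnd, riemann]; abel)
    (fun c a w => by
      rw [← map_smul]; congr 1; ext u; simp [riemannEnd, riemann, smul_sub, smul_add])
    (fun v a b => by
      rw [← map_add]; congr 1; ext u; simp [riemannEnd, riemann]; abel)
    (fun c v a => by
      rw [← map_smul]; congr 1; ext u; simp [riemannEnd, riemann, smul_sub, smul_add])

/-- The scalar curvature, the metric trace of the Ricci tensor. -/
def scalar [FiniteDimensional ℝ E] (G : E → E →L[ℝ] E →L[ℝ] ℝ) (y : E) : ℝ :=
  LinearMap.trace ℝ E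
    ((sharp G y).toLinearMap ∘ₗ LinearMap.toContinuousLinearMap.toLinearMap ∘ₗ ricci G y)

/-- The Hessian `∇²f(u, v) = D²f(u, v) - Df(Γ(u, v))`. -/
def hessian (G : E → E →L[ℝ] E →L[ℝ] ℝ) (f : E → ℝ) (y : E) : E →L[ℝ] E →L[ℝ] ℝ :=
  fderiv ℝ (fderiv ℝ f) y -
    (ContinuousLinearMap.compL ℝ E E ℝ (fderiv ℝ f y)).comp (christoffel G y)

/-- The Laplace-Beltrami operator `∇^i ∇_i f`, the metric trace of the Hessian. -/
def laplacian (G : E → E →L[ℝ] E →L[ℝ] ℝ) (f : E → ℝ) (y : E) : ℝ :=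
  LinearMap.trace ℝ E ((sharp G y).comp (hessian G f y)).toLinearMap

end MetricInCoordinates

/-! ### Pseudo-Riemannian manifolds (without boundary) -/

/-- The pullback `A^* b = b (A ·, A ·)` of a bilinear form by a linear map. -/
def pullbackForm {V W : Type*} [AddCommGroup V] [Module ℝ V] [TopologicalSpace V]
    [AddCommGroup W] [Module ℝ W] [TopologicalSpace W]
    (A : V →L[ℝ] W) (b : W →L[ℝ] W →L[ℝ] ℝ) : V →L[ℝ] V →L[ℝ] ℝ :=
  (ContinuousLinearMap.precomp ℝ A).comp (b.comp A)

theorem pullbackForm_apply {V W : Type*} [AddCommGroup V] [Module ℝ V] [TopologicalSpace V]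
    [AddCommGroup W] [Module ℝ W] [TopologicalSpace W]
    (A : V →L[ℝ] W) (b : W →L[ℝ] W →L[ℝ] ℝ) (v w : V) :
    pullbackForm A b v w = b (A v) (A w) := rfl

section Manifold

variable {E : Type*} [NormedAddCommGroup E] [NormedSpace ℝ E]
  {H : Type*} [TopologicalSpace H] (I : ModelWithCorners ℝ E H)
  (M : Type*) [TopologicalSpace M] [ChartedSpace H M] [IsManifold I ∞ M]

/-- A smooth pseudo-Riemannian metric: a smooth field of symmetric nondegenerate bilinear forms on
the tangent spaces, of any signature. -/
structure PseudoRiemannianMetric where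
  val (x : M) : TangentSpace I x →L[ℝ] TangentSpace I x →L[ℝ] ℝ
  symm (x : M) (v w : TangentSpace I x) : val x v w = val x w v
  nondegenerate (x : M) (v : TangentSpace I x) (hv : ∀ w, val x v w = 0) : v = 0
  contMDiff : ContMDiff I (I.prod 𝓘(ℝ, E →L[ℝ] E →L[ℝ] ℝ)) ∞
    (fun x ↦ Bundle.TotalSpace.mk' (E →L[ℝ] E →L[ℝ] ℝ)
      (E := fun x : M ↦ TangentSpace I x →L[ℝ] TangentSpace I x →L[ℝ] ℝ) x (val x))

namespace PseudoRiemannianMetric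

variable {I M} (g : PseudoRiemannianMetric I M)

/-- The metric read in the preferred chart at `x₀`: its pullback by the inverse of the chart. -/
def inChart (x₀ : M) (y : E) : E →L[ℝ] E →L[ℝ] ℝ :=
  pullbackForm (mfderiv 𝓘(ℝ, E) I (extChartAt I x₀).symm y) (g.val ((extChartAt I x₀).symm y))

/-- The scalar curvature. As it does not depend on coordinates, it is computed at each point in the
preferred chart at that point. -/
def scalarCurvature [FiniteDimensional ℝ E] (x : M) : ℝ :=
  MetricInCoordinates.scalar (g.inChart x) (extChartAt I x x)

/-- The Laplace-Beltrami operator, computed at each point in the preferred chart at that point. -/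
def laplacian (f : M → ℝ) (x : M) : ℝ :=
  MetricInCoordinates.laplacian (g.inChart x) (f ∘ (extChartAt I x).symm) (extChartAt I x x)

/-- The gradient of `f`, that is the vector `∇f` with `g(∇f, v) = df(v)` for all `v`. -/
def gradient (f : M → ℝ) (x : M) : TangentSpace I x :=
  (g.val x).inverse (mfderiv I 𝓘(ℝ, ℝ) f x)

/-- `|∇f|² = g(∇f, ∇f)`, which may be negative or zero for an indefinite metric. -/
def normSqGradient (f : M → ℝ) (x : M) : ℝ :=
  g.val x (g.gradient f x) (g.gradient f x)

end PseudoRiemannianMetric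

end Manifold

/-! ### Base conformal warped products -/

section Product

open Bundle

/-- Smoothness of a field of bilinear forms is smoothness of its components in charts. -/
theorem contMDiffAt_form_iff {E : Type*} [NormedAddCommGroup E] [NormedSpace ℝ E]
    {H : Type*} [TopologicalSpace H] {I : ModelWithCorners ℝ E H}
    {M : Type*} [TopologicalSpace M] [ChartedSpace H M] [IsManifold I ∞ M]
    (h : ∀ x : M, TangentSpace I x →L[ℝ] TangentSpace I x →L[ℝ] ℝ) (x₀ : M) :
    ContMDiffAt I (I.prod 𝓘(ℝ, E →L[ℝ] E →L[ℝ] ℝ)) ∞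
      (fun x ↦ TotalSpace.mk' (E →L[ℝ] E →L[ℝ] ℝ)
        (E := fun x : M ↦ TangentSpace I x →L[ℝ] TangentSpace I x →L[ℝ] ℝ) x (h x)) x₀ ↔
    ContMDiffAt I 𝓘(ℝ, E →L[ℝ] E →L[ℝ] ℝ) ∞
      (fun x ↦ pullbackForm ((trivializationAt E (TangentSpace I) x₀).symmL ℝ x) (h x)) x₀ := by
  rw [contMDiffAt_section]
  refine Filter.EventuallyEq.contMDiffAt_iff ?_
  have hx : ∀ᶠ x in 𝓝 x₀, x ∈ (trivializationAt E (TangentSpace I : M → Type _) x₀).baseSet :=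
    (trivializationAt E (TangentSpace I) x₀).open_baseSet.mem_nhds
      (mem_baseSet_trivializationAt E (TangentSpace I) x₀)
  filter_upwards [hx] with x hx
  ext v w
  rw [hom_trivializationAt_apply, inCoordinates_apply_eq₂ hx hx (by simp)]
  simp only [Trivial.fiberBundle_trivializationAt', Trivial.linearMapAt_trivialization,
    LinearMap.id_coe, id_eq, pullbackForm_apply]
  have hs (z : E) := (trivializationAt E (TangentSpace I) x₀).symmL_apply (R := ℝ) hx z
  exact congrArg₂ (fun a b ↦ h x a b) (hs v).symm (hs w).symm

variable {E : Type*} [NormedAddCommGroup E] [NormedSpace ℝ E]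
  {H : Type*} [TopologicalSpace H] {I : ModelWithCorners ℝ E H}
  {M : Type*} [TopologicalSpace M] [ChartedSpace H M] [IsManifold I ∞ M]
  {E' : Type*} [NormedAddCommGroup E'] [NormedSpace ℝ E']
  {H' : Type*} [TopologicalSpace H'] {J : ModelWithCorners ℝ E' H'}
  {N : Type*} [TopologicalSpace N] [ChartedSpace H' N] [IsManifold J ∞ N]

/-- The pullback of a smooth field of bilinear forms by a smooth map is smooth. -/
theorem contMDiff_pullbackForm (g : PseudoRiemannianMetric J N) {f : M → N}
    (hf : ContMDiff I J ∞ f) :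
    ContMDiff I (I.prod 𝓘(ℝ, E →L[ℝ] E →L[ℝ] ℝ)) ∞
      (fun x ↦ TotalSpace.mk' (E →L[ℝ] E →L[ℝ] ℝ)
        (E := fun x : M ↦ TangentSpace I x →L[ℝ] TangentSpace I x →L[ℝ] ℝ) x
        (pullbackForm (mfderiv I J f x) (g.val (f x)))) := by
  intro x₀
  rw [contMDiffAt_form_iff]
  have h1 := ((contMDiffAt_form_iff g.val (f x₀)).1 (g.contMDiff (f x₀))).comp x₀ (hf x₀)
  have h2 : ContMDiffAt I 𝓘(ℝ, E →L[ℝ] E') ∞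
      (inTangentCoordinates I J id f (fun x ↦ mfderiv I J f x) x₀) x₀ :=
    (hf x₀).mfderiv_const le_rfl
  have h3 : ContMDiffAt I 𝓘(ℝ, E →L[ℝ] E →L[ℝ] ℝ) ∞
      (fun x ↦ (((ContinuousLinearMap.compL ℝ E E' ℝ).flip
        (inTangentCoordinates I J id f (fun x ↦ mfderiv I J f x) x₀ x)).comp
        (pullbackForm ((trivializationAt E' (TangentSpace J) (f x₀)).symmL ℝ (f x))
          (g.val (f x)))).comp
        (inTangentCoordinates I J id f (fun x ↦ mfderiv I J f x) x₀ x)) x₀ := by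
    refine ContMDiffAt.clm_comp (ContMDiffAt.clm_comp ?_ h1) h2
    exact ((ContinuousLinearMap.compL ℝ E E' ℝ).flip.contDiff.contMDiff.contMDiffAt).comp x₀ h2
  refine h3.congr_of_eventuallyEq ?_
  have hx : ∀ᶠ x in 𝓝 x₀, x ∈ (trivializationAt E (TangentSpace I : M → Type _) x₀).baseSet :=
    (trivializationAt E (TangentSpace I) x₀).open_baseSet.mem_nhds
      (mem_baseSet_trivializationAt E (TangentSpace I) x₀)
  have hy : ∀ᶠ x in 𝓝 x₀,
      f x ∈ (trivializationAt E' (TangentSpace J : N → Type _) (f x₀)).baseSet :=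
    hf.continuous.continuousAt.eventually
      ((trivializationAt E' (TangentSpace J) (f x₀)).open_baseSet.mem_nhds
        (mem_baseSet_trivializationAt E' (TangentSpace J) (f x₀)))
  filter_upwards [hx, hy] with x hx hy
  have key : ∀ v : E, (trivializationAt E' (TangentSpace J) (f x₀)).symmL ℝ (f x)
      (inTangentCoordinates I J id f (fun x ↦ mfderiv I J f x) x₀ x v) =
      mfderiv I J f x ((trivializationAt E (TangentSpace I) x₀).symmL ℝ x v) := by
    intro v
    exact (trivializationAt E' (TangentSpace J) (f x₀)).symmL_continuousLinearMapAt hy _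
  ext v w
  exact (congrArg₂ (fun a b ↦ g.val (f x) a b) (key v) (key w)).symm

namespace PseudoRiemannianMetric

/-- The special base conformal warped product metric `ψ^(2μ) g_B + ψ² g_F` on `B × F`, for a
smooth positive function `ψ` on `B`. -/
def specialBaseConformalWarpedProduct (gB : PseudoRiemannianMetric I M)
    (gF : PseudoRiemannianMetric J N) (μ : ℝ) (ψ : M → ℝ)
    (hψ : ContMDiff I 𝓘(ℝ, ℝ) ∞ ψ) (hpos : ∀ b, 0 < ψ b) :
    PseudoRiemannianMetric (I.prod J) (M × N) where
  val p := (ψ p.1 ^ (2 * μ)) • pullbackForm (mfderiv (I.prod J) I Prod.fst p) (gB.val p.1) +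
    (ψ p.1 ^ 2) • pullbackForm (mfderiv (I.prod J) J Prod.snd p) (gF.val p.2)
  symm p v w := congrArg₂ (fun a b : ℝ ↦ ψ p.1 ^ (2 * μ) * a + ψ p.1 ^ 2 * b)
    (gB.symm p.1 _ _) (gF.symm p.2 _ _)
  nondegenerate p v hv := by
    have hc : ψ p.1 ^ (2 * μ) ≠ 0 := (Real.rpow_pos_of_pos (hpos _) _).ne'
    have hw : ψ p.1 ^ 2 ≠ 0 := (pow_pos (hpos _) _).ne'
    rw [mfderiv_fst, mfderiv_snd] at hv
    refine Prod.ext (gB.nondegenerate p.1 v.1 fun w ↦ ?_) (gF.nondegenerate p.2 v.2 fun w ↦ ?_)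
    · have h := hv (w, 0)
      have h' : ψ p.1 ^ (2 * μ) * gB.val p.1 v.1 w + ψ p.1 ^ 2 * gF.val p.2 v.2 0 = 0 := h
      simpa [hc] using h'
    · have h := hv (0, w)
      have h' : ψ p.1 ^ (2 * μ) * gB.val p.1 v.1 0 + ψ p.1 ^ 2 * gF.val p.2 v.2 w = 0 := h
      simpa [(hpos p.1).ne'] using h'
  contMDiff := by
    have h1 : ContMDiff (I.prod J) 𝓘(ℝ, ℝ) ∞ (fun p : M × N ↦ ψ p.1 ^ (2 * μ)) := by
      intro p
      have h := (Real.contDiffAt_rpow_const_of_ne (p := 2 * μ) (n := ∞)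
        (hpos p.1).ne').contMDiffAt
      exact h.comp p ((hψ.comp (contMDiff_fst (I := I) (J := J))) p)
    have h2 : ContMDiff (I.prod J) 𝓘(ℝ, ℝ) ∞ (fun p : M × N ↦ ψ p.1 ^ 2) :=
      (hψ.comp contMDiff_fst).pow 2
    exact (h1.smul_section (contMDiff_pullbackForm gB contMDiff_fst)).add_section
      (h2.smul_section (contMDiff_pullbackForm gF contMDiff_snd))

end PseudoRiemannianMetric

end Product

end

noncomputable section

namespace MetricInCoordinates

section Basic

variable {E : Type*} [NormedAddCommGroup E] [NormedSpace ℝ E]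

/-- `G` is, near `y`, a twice continuously differentiable field of symmetric nondegenerate bilinear
forms. -/
structure IsMetricAt (G : E → E →L[ℝ] E →L[ℝ] ℝ) (y : E) : Prop where
  contDiffAt : ContDiffAt ℝ 2 G y
  eventually_symm : ∀ᶠ x in 𝓝 y, ∀ v w, G x v w = G x w v
  eventually_isInvertible : ∀ᶠ x in 𝓝 y, (G x).IsInvertible

/-- The gradient of `f` with respect to `G`. -/
def gradient (G : E → E →L[ℝ] E →L[ℝ] ℝ) (f : E → ℝ) (y : E) : E :=
  sharp G y (fderiv ℝ f y)

variable {G : E → E →L[ℝ] E →L[ℝ] ℝ} {y : E} {f : E → ℝ}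

theorem christoffel_congr {G' : E → E →L[ℝ] E →L[ℝ] ℝ} (h : G =ᶠ[𝓝 y] G') :
    christoffel G =ᶠ[𝓝 y] christoffel G' := by
  filter_upwards [h, h.fderiv (𝕜 := ℝ)] with x hx hx'
  simp only [christoffel, christoffelFirst, sharp, hx, hx']

theorem scalar_congr [FiniteDimensional ℝ E] {G' : E → E →L[ℝ] E →L[ℝ] ℝ} (h : G =ᶠ[𝓝 y] G') :
    scalar G y = scalar G' y := by
  have h1 := (christoffel_congr h).eq_of_nhds
  have h2 := ((christoffel_congr h).fderiv (𝕜 := ℝ)).eq_of_nhds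
  simp only [scalar, ricci, riemannEnd, riemann, sharp, h.eq_of_nhds, h1, h2]

namespace IsMetricAt

theorem eventually (h : IsMetricAt G y) : ∀ᶠ x in 𝓝 y, IsMetricAt G x := by
  filter_upwards [h.contDiffAt.eventually (by simp), h.eventually_symm.eventually_nhds,
    h.eventually_isInvertible.eventually_nhds] with x h1 h2 h3 using ⟨h1, h2, h3⟩

theorem symm (h : IsMetricAt G y) (v w : E) : G y v w = G y w v :=
  h.eventually_symm.self_of_nhds v w

theorem isInvertible (h : IsMetricAt G y) : (G y).IsInvertible :=
  h.eventually_isInvertible.self_of_nhds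

theorem apply_sharp (h : IsMetricAt G y) (l : E →L[ℝ] ℝ) : G y (sharp G y l) = l :=
  h.isInvertible.self_apply_inverse l

theorem sharp_apply (h : IsMetricAt G y) (v : E) : sharp G y (G y v) = v :=
  h.isInvertible.inverse_apply_self v

theorem sharp_eq (h : IsMetricAt G y) {l : E →L[ℝ] ℝ} {v : E} (hv : ∀ w, G y v w = l w) :
    sharp G y l = v := by
  rw [← h.sharp_apply v]
  congr 1
  ext w
  exact (hv w).symm

theorem differentiableAt (h : IsMetricAt G y) : DifferentiableAt ℝ G y :=
  h.contDiffAt.differentiableAt (by simp)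

theorem fderiv_symm (h : IsMetricAt G y) (u v w : E) :
    fderiv ℝ G y u v w = fderiv ℝ G y u w v := by
  have e : ∀ a b, fderiv ℝ (fun x => G x a b) y u = fderiv ℝ G y u a b := by
    intro a b
    have h1 : HasFDerivAt (fun x => G x a b) _ y :=
      ((h.differentiableAt.hasFDerivAt.clm_apply (hasFDerivAt_const a y)).clm_apply
        (hasFDerivAt_const b y))
    rw [h1.fderiv]
    simp
  rw [← e, ← e]
  congr 1
  refine Filter.EventuallyEq.fderiv_eq ?_
  filter_upwards [h.eventually_symm] with x hx using hx v w

theorem apply_christoffel (h : IsMetricAt G y) (u v w : E) :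
    G y (christoffel G y u v) w =
      (1 / 2) * (fderiv ℝ G y u v w + fderiv ℝ G y v u w - fderiv ℝ G y w u v) := by
  rw [christoffel_apply, h.apply_sharp, christoffelFirst_apply]

theorem christoffel_symm (h : IsMetricAt G y) (u v : E) :
    christoffel G y u v = christoffel G y v u := by
  rw [christoffel_apply, christoffel_apply]
  congr 1
  ext w
  rw [christoffelFirst_apply, christoffelFirst_apply, h.fderiv_symm w u v]
  ring

/-- The Levi-Civita connection is metric. -/
theorem fderiv_apply (h : IsMetricAt G y) (u v w : E) :
    fderiv ℝ G y u v w = G y (christoffel G y u v) w + G y (christoffel G y u w) v := by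
  rw [h.apply_christoffel, h.apply_christoffel, h.fderiv_symm u w v, h.fderiv_symm v u w,
    h.fderiv_symm w u v]
  ring

theorem christoffel_eq (h : IsMetricAt G y) {u v z : E}
    (hz : ∀ w, G y z w =
      (1 / 2) * (fderiv ℝ G y u v w + fderiv ℝ G y v u w - fderiv ℝ G y w u v)) :
    christoffel G y u v = z := by
  rw [christoffel_apply]
  refine h.sharp_eq fun w => ?_
  rw [hz, christoffelFirst_apply]

theorem contDiffAt_sharp [CompleteSpace E] (h : IsMetricAt G y) : ContDiffAt ℝ 2 (sharp G) y :=
  h.isInvertible.contDiffAt_map_inverse.comp y h.contDiffAt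

theorem differentiableAt_christoffel [CompleteSpace E] (h : IsMetricAt G y) :
    DifferentiableAt ℝ (christoffel G) y := by
  have h1 : DifferentiableAt ℝ (fderiv ℝ G) y :=
    (h.contDiffAt.fderiv_right (m := 1) (by norm_num)).differentiableAt (by simp)
  have h2 : DifferentiableAt ℝ (sharp G) y := h.contDiffAt_sharp.differentiableAt (by simp)
  have hf : DifferentiableAt ℝ (fun x => (fderiv ℝ G x).flip) y :=
    (ContinuousLinearMap.flipₗᵢ ℝ E E (E →L[ℝ] ℝ)).toContinuousLinearEquiv.differentiableAt.comp
      y h1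
  unfold christoffel
  refine ((ContinuousLinearMap.compL ℝ E (E →L[ℝ] ℝ) E).differentiableAt.comp y h2).clm_comp ?_
  unfold christoffelFirst
  exact DifferentiableAt.const_smul ((h1.add hf).sub ((differentiableAt_const _).clm_comp hf))
    (1 / 2 : ℝ)

theorem fderiv_christoffel_apply [CompleteSpace E] (h : IsMetricAt G y) (u v w : E) :
    fderiv ℝ (fun x => christoffel G x u v) y w = fderiv ℝ (christoffel G) y w u v := by
  have h1 : HasFDerivAt (fun x => christoffel G x u v) _ y :=
    ((h.differentiableAt_christoffel.hasFDerivAt.clm_apply (hasFDerivAt_const u y)).clm_apply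
      (hasFDerivAt_const v y))
  rw [h1.fderiv]
  simp

theorem apply_gradient (h : IsMetricAt G y) (f : E → ℝ) (v : E) :
    G y (gradient G f y) v = fderiv ℝ f y v := by
  rw [gradient, h.apply_sharp]

theorem differentiableAt_gradient [CompleteSpace E] (h : IsMetricAt G y)
    (hf : ContDiffAt ℝ 2 f y) : DifferentiableAt ℝ (gradient G f) y :=
  (h.contDiffAt_sharp.differentiableAt (by simp)).clm_apply
    ((hf.fderiv_right (m := 1) (by norm_num)).differentiableAt (by simp))

theorem hessian_apply (G : E → E →L[ℝ] E →L[ℝ] ℝ) (f : E → ℝ) (y u v : E) :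
    hessian G f y u v = fderiv ℝ (fderiv ℝ f) y u v - fderiv ℝ f y (christoffel G y u v) := rfl

theorem hessian_symm (h : IsMetricAt G y) (hf : ContDiffAt ℝ 2 f y) (u v : E) :
    hessian G f y u v = hessian G f y v u := by
  rw [hessian_apply, hessian_apply, h.christoffel_symm u v,
    (hf.isSymmSndFDerivAt (by simp)).eq u v]

/-- The covariant derivative of the gradient corresponds to the Hessian. -/
theorem fderiv_gradient [CompleteSpace E] (h : IsMetricAt G y) (hf : ContDiffAt ℝ 2 f y) (u : E) :
    fderiv ℝ (gradient G f) y u =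
      sharp G y (hessian G f y u) - christoffel G y u (gradient G f y) := by
  rw [eq_sub_iff_add_eq, eq_comm]
  refine h.sharp_eq fun w => ?_
  have h1 : HasFDerivAt (fun x => G x (gradient G f x)) _ y :=
    h.differentiableAt.hasFDerivAt.clm_apply (h.differentiableAt_gradient hf).hasFDerivAt
  have h2 : (fun x => G x (gradient G f x)) =ᶠ[𝓝 y] fderiv ℝ f := by
    filter_upwards [h.eventually] with x hx
    rw [gradient, hx.apply_sharp]
  have h3 := h2.fderiv_eq (𝕜 := ℝ)
  rw [h1.fderiv] at h3
  have h4 := congrArg (fun l => l u w) h3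
  simp only [add_apply, ContinuousLinearMap.comp_apply, ContinuousLinearMap.flip_apply] at h4
  rw [hessian_apply, ← h4, h.fderiv_apply, map_add, add_apply, h.symm (christoffel G y u w),
    h.apply_gradient]
  ring

end IsMetricAt

end Basic

section Warped

variable {E : Type*} [NormedAddCommGroup E] [NormedSpace ℝ E]
  {E' : Type*} [NormedAddCommGroup E'] [NormedSpace ℝ E']

/-- The metric `e^(2μφ) GB + e^(2φ) GF` on a product, where `φ` is a function on the first
factor. -/
def warped (GB : E → E →L[ℝ] E →L[ℝ] ℝ) (GF : E' → E' →L[ℝ] E' →L[ℝ] ℝ) (μ : ℝ) (φ : E → ℝ)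
    (x : E × E') : E × E' →L[ℝ] E × E' →L[ℝ] ℝ :=
  Real.exp (2 * μ * φ x.1) • pullbackForm (ContinuousLinearMap.fst ℝ E E') (GB x.1) +
    Real.exp (2 * φ x.1) • pullbackForm (ContinuousLinearMap.snd ℝ E E') (GF x.2)

variable {GB : E → E →L[ℝ] E →L[ℝ] ℝ} {GF : E' → E' →L[ℝ] E' →L[ℝ] ℝ} {μ : ℝ} {φ : E → ℝ}
  {y : E} {z : E'}

theorem warped_apply (x u v : E × E') :
    warped GB GF μ φ x u v =
      Real.exp (2 * μ * φ x.1) * GB x.1 u.1 v.1 + Real.exp (2 * φ x.1) * GF x.2 u.2 v.2 := rfl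

theorem isInvertible_warped {x : E × E'} (hB : (GB x.1).IsInvertible)
    (hF : (GF x.2).IsInvertible) : (warped GB GF μ φ x).IsInvertible := by
  refine ContinuousLinearMap.IsInvertible.of_inverse (g :=
    (Real.exp (-(2 * μ * φ x.1)) • ((GB x.1).inverse.comp
      (ContinuousLinearMap.precomp ℝ (ContinuousLinearMap.inl ℝ E E')))).prod
    (Real.exp (-(2 * φ x.1)) • ((GF x.2).inverse.comp
      (ContinuousLinearMap.precomp ℝ (ContinuousLinearMap.inr ℝ E E'))))) ?_ ?_
  · ext l v
    · simp [warped_apply, hB.self_apply_inverse, ← mul_assoc, ← Real.exp_add]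
    · simp [warped_apply, hF.self_apply_inverse, ← mul_assoc, ← Real.exp_add]
  · have e1 : ∀ v : E × E', (warped GB GF μ φ x v).comp (ContinuousLinearMap.inl ℝ E E') =
        Real.exp (2 * μ * φ x.1) • GB x.1 v.1 := by
      intro v; ext w; simp [warped_apply]
    have e2 : ∀ v : E × E', (warped GB GF μ φ x v).comp (ContinuousLinearMap.inr ℝ E E') =
        Real.exp (2 * φ x.1) • GF x.2 v.2 := by
      intro v; ext w; simp [warped_apply]
    refine ContinuousLinearMap.ext fun v => Prod.ext ?_ ?_
    · simp [e1, hB.inverse_apply_self, smul_smul, ← Real.exp_add]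
    · simp [e2, hF.inverse_apply_self, smul_smul, ← Real.exp_add]

theorem contDiffAt_warped (hB : ContDiffAt ℝ 2 GB y) (hF : ContDiffAt ℝ 2 GF z)
    (hφ : ContDiffAt ℝ 2 φ y) : ContDiffAt ℝ 2 (warped GB GF μ φ) (y, z) := by
  have hφ' : ContDiffAt ℝ 2 (fun x : E × E' => φ x.1) (y, z) := hφ.comp (y, z) contDiffAt_fst
  have hB' : ContDiffAt ℝ 2 (fun x : E × E' => GB x.1) (y, z) := hB.comp (y, z) contDiffAt_fst
  have hF' : ContDiffAt ℝ 2 (fun x : E × E' => GF x.2) (y, z) := hF.comp (y, z) contDiffAt_snd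
  unfold warped pullbackForm
  exact ((contDiffAt_const.mul hφ').exp.smul
    (contDiffAt_const.clm_comp (hB'.clm_comp contDiffAt_const))).add
    ((contDiffAt_const.mul hφ').exp.smul
    (contDiffAt_const.clm_comp (hF'.clm_comp contDiffAt_const)))

theorem isMetricAt_warped (hB : IsMetricAt GB y) (hF : IsMetricAt GF z)
    (hφ : ContDiffAt ℝ 2 φ y) : IsMetricAt (warped GB GF μ φ) (y, z) where
  contDiffAt := contDiffAt_warped hB.contDiffAt hF.contDiffAt hφ
  eventually_symm := by
    filter_upwards [continuousAt_fst.eventually hB.eventually_symm,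
      continuousAt_snd.eventually hF.eventually_symm] with x h1 h2 v w
    rw [warped_apply, warped_apply, h1, h2]
  eventually_isInvertible := by
    filter_upwards [continuousAt_fst.eventually hB.eventually_isInvertible,
      continuousAt_snd.eventually hF.eventually_isInvertible] with x h1 h2
    exact isInvertible_warped h1 h2

theorem sharp_warped (hB : IsMetricAt GB y) (hF : IsMetricAt GF z) (hφ : ContDiffAt ℝ 2 φ y)
    (l : E × E' →L[ℝ] ℝ) :
    sharp (warped GB GF μ φ) (y, z) l =
      (Real.exp (-(2 * μ * φ y)) • sharp GB y (l.comp (ContinuousLinearMap.inl ℝ E E')),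
        Real.exp (-(2 * φ y)) • sharp GF z (l.comp (ContinuousLinearMap.inr ℝ E E'))) := by
  refine (isMetricAt_warped hB hF hφ).sharp_eq fun w => ?_
  have hw : l w = l (w.1, 0) + l (0, w.2) := by rw [← map_add]; simp
  rw [warped_apply, hw]
  simp [hB.apply_sharp, hF.apply_sharp, ← mul_assoc, ← Real.exp_add]

theorem fderiv_warped (hB : IsMetricAt GB y) (hF : IsMetricAt GF z) (hφ : ContDiffAt ℝ 2 φ y)
    (w u v : E × E') :
    fderiv ℝ (warped GB GF μ φ) (y, z) w u v =
      Real.exp (2 * μ * φ y) * (2 * μ * fderiv ℝ φ y w.1 * GB y u.1 v.1 +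
        fderiv ℝ GB y w.1 u.1 v.1) +
      Real.exp (2 * φ y) * (2 * fderiv ℝ φ y w.1 * GF z u.2 v.2 +
        fderiv ℝ GF z w.2 u.2 v.2) := by
  have hW : HasFDerivAt (fun x => warped GB GF μ φ x u v) _ (y, z) :=
    (((contDiffAt_warped hB.contDiffAt hF.contDiffAt hφ).differentiableAt
      (by simp)).hasFDerivAt.clm_apply (hasFDerivAt_const u _)).clm_apply (hasFDerivAt_const v _)
  have hφ' : HasFDerivAt (fun x : E × E' => φ x.1) _ (y, z) :=
    HasFDerivAt.comp (y, z) (f := Prod.fst) (hφ.differentiableAt (by simp)).hasFDerivAt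
      hasFDerivAt_fst
  have hB' : HasFDerivAt (fun x : E × E' => GB x.1) _ (y, z) :=
    HasFDerivAt.comp (y, z) (f := Prod.fst) hB.differentiableAt.hasFDerivAt hasFDerivAt_fst
  have hF' : HasFDerivAt (fun x : E × E' => GF x.2) _ (y, z) :=
    HasFDerivAt.comp (y, z) (f := Prod.snd) hF.differentiableAt.hasFDerivAt hasFDerivAt_snd
  have h := ((hφ'.const_mul (2 * μ)).exp.mul ((hB'.clm_apply (hasFDerivAt_const u.1 _)).clm_apply
    (hasFDerivAt_const v.1 _))).add ((hφ'.const_mul 2).exp.mul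
    ((hF'.clm_apply (hasFDerivAt_const u.2 _)).clm_apply (hasFDerivAt_const v.2 _)))
  have h2 := congrArg (fun l => l w) (hW.unique h)
  simp at h2
  rw [h2]
  ring

/-- The Christoffel symbols of `e^(2μφ) GB`. -/
def conformalChristoffel (GB : E → E →L[ℝ] E →L[ℝ] ℝ) (μ : ℝ) (φ : E → ℝ) (y u v : E) : E :=
  christoffel GB y u v +
    μ • (fderiv ℝ φ y u • v + fderiv ℝ φ y v • u - GB y u v • gradient GB φ y)

theorem christoffel_warped (hB : IsMetricAt GB y) (hF : IsMetricAt GF z)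
    (hφ : ContDiffAt ℝ 2 φ y) (u v : E × E') :
    christoffel (warped GB GF μ φ) (y, z) u v =
      (conformalChristoffel GB μ φ y u.1 v.1 -
          (Real.exp (2 * (1 - μ) * φ y) * GF z u.2 v.2) • gradient GB φ y,
        christoffel GF z u.2 v.2 + fderiv ℝ φ y u.1 • v.2 + fderiv ℝ φ y v.1 • u.2) := by
  refine (isMetricAt_warped hB hF hφ).christoffel_eq fun w => ?_
  have e : Real.exp (2 * φ y) = Real.exp (2 * μ * φ y) * Real.exp (2 * (1 - μ) * φ y) := by
    rw [← Real.exp_add]; ring_nf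
  rw [fderiv_warped hB hF hφ, fderiv_warped hB hF hφ, fderiv_warped hB hF hφ, warped_apply]
  simp only [conformalChristoffel, map_add, map_sub, map_smul, add_apply, sub_apply, smul_apply,
    smul_eq_mul, hB.apply_gradient, hB.apply_christoffel, hF.apply_christoffel]
  rw [hB.symm u.1 w.1, hF.symm u.2 w.2, hB.symm u.1 v.1, hF.symm u.2 v.2, hB.symm v.1 w.1,
    hF.symm v.2 w.2, e]
  ring

end Warped

section WarpedCurvature

variable {E : Type*} [NormedAddCommGroup E] [NormedSpace ℝ E] [CompleteSpace E]
  {E' : Type*} [NormedAddCommGroup E'] [NormedSpace ℝ E'] [CompleteSpace E']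
  {GB : E → E →L[ℝ] E →L[ℝ] ℝ} {GF : E' → E' →L[ℝ] E' →L[ℝ] ℝ} {μ : ℝ} {φ : E → ℝ}
  {y : E} {z : E'}

theorem exists_hasFDerivAt_conformalChristoffel (hB : IsMetricAt GB y) (hφ : ContDiffAt ℝ 2 φ y)
    (μ : ℝ) (u v : E) :
    ∃ L : E →L[ℝ] E, HasFDerivAt (fun x => conformalChristoffel GB μ φ x u v) L y ∧ ∀ w,
      L w = fderiv ℝ (christoffel GB) y w u v +
        μ • (fderiv ℝ (fderiv ℝ φ) y w u • v + fderiv ℝ (fderiv ℝ φ) y w v • u -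
          fderiv ℝ GB y w u v • gradient GB φ y -
          GB y u v • fderiv ℝ (gradient GB φ) y w) := by
  have h1 : HasFDerivAt (fderiv ℝ φ) _ y :=
    ((hφ.fderiv_right (m := 1) (by norm_num)).differentiableAt (by simp)).hasFDerivAt
  have h2 := (hB.differentiableAt_gradient hφ).hasFDerivAt
  have h3 := hB.differentiableAt.hasFDerivAt
  have h4 := hB.differentiableAt_christoffel.hasFDerivAt
  refine ⟨_, ((h4.clm_apply (hasFDerivAt_const u y)).clm_apply (hasFDerivAt_const v y)).add
    ((((h1.clm_apply (hasFDerivAt_const u y)).smul (hasFDerivAt_const v y)).add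
      ((h1.clm_apply (hasFDerivAt_const v y)).smul (hasFDerivAt_const u y))).sub
      (((h3.clm_apply (hasFDerivAt_const u y)).clm_apply (hasFDerivAt_const v y)).smul
        h2) |>.const_smul μ), fun w => ?_⟩
  simp
  module

theorem fderiv_christoffel_warped (hB : IsMetricAt GB y) (hF : IsMetricAt GF z)
    (hφ : ContDiffAt ℝ 2 φ y) (w u v : E × E') :
    fderiv ℝ (christoffel (warped GB GF μ φ)) (y, z) w u v =
      (fderiv ℝ (christoffel GB) y w.1 u.1 v.1 +
        μ • (fderiv ℝ (fderiv ℝ φ) y w.1 u.1 • v.1 + fderiv ℝ (fderiv ℝ φ) y w.1 v.1 • u.1 -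
          fderiv ℝ GB y w.1 u.1 v.1 • gradient GB φ y -
          GB y u.1 v.1 • fderiv ℝ (gradient GB φ) y w.1) -
        Real.exp (2 * (1 - μ) * φ y) • ((2 * (1 - μ) * fderiv ℝ φ y w.1 * GF z u.2 v.2 +
          fderiv ℝ GF z w.2 u.2 v.2) • gradient GB φ y +
          GF z u.2 v.2 • fderiv ℝ (gradient GB φ) y w.1),
      fderiv ℝ (christoffel GF) z w.2 u.2 v.2 + fderiv ℝ (fderiv ℝ φ) y w.1 u.1 • v.2 +
        fderiv ℝ (fderiv ℝ φ) y w.1 v.1 • u.2) := by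
  rw [← (isMetricAt_warped hB hF hφ).fderiv_christoffel_apply]
  have e : (fun x => christoffel (warped GB GF μ φ) x u v) =ᶠ[𝓝 (y, z)] fun x : E × E' =>
      (conformalChristoffel GB μ φ x.1 u.1 v.1 -
          (Real.exp (2 * (1 - μ) * φ x.1) * GF x.2 u.2 v.2) • gradient GB φ x.1,
        christoffel GF x.2 u.2 v.2 + fderiv ℝ φ x.1 u.1 • v.2 + fderiv ℝ φ x.1 v.1 • u.2) := by
    filter_upwards [continuousAt_fst.eventually hB.eventually,
      continuousAt_snd.eventually hF.eventually,
      continuousAt_fst.eventually (hφ.eventually (by simp))] with x h1 h2 h3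
    exact christoffel_warped h1 h2 h3 u v
  rw [e.fderiv_eq]
  obtain ⟨L, hL, hL'⟩ := exists_hasFDerivAt_conformalChristoffel hB hφ μ u.1 v.1
  have k1 : HasFDerivAt (fun x : E × E' => conformalChristoffel GB μ φ x.1 u.1 v.1) _ (y, z) :=
    HasFDerivAt.comp (y, z) (f := Prod.fst) hL hasFDerivAt_fst
  have k2 : HasFDerivAt (fun x : E × E' => φ x.1) _ (y, z) :=
    HasFDerivAt.comp (y, z) (f := Prod.fst) (hφ.differentiableAt (by simp)).hasFDerivAt
      hasFDerivAt_fst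
  have k3 : HasFDerivAt (fun x : E × E' => GF x.2) _ (y, z) :=
    HasFDerivAt.comp (y, z) (f := Prod.snd) hF.differentiableAt.hasFDerivAt hasFDerivAt_snd
  have k4 : HasFDerivAt (fun x : E × E' => gradient GB φ x.1) _ (y, z) :=
    HasFDerivAt.comp (y, z) (f := Prod.fst) (hB.differentiableAt_gradient hφ).hasFDerivAt
      hasFDerivAt_fst
  have k5 : HasFDerivAt (fun x : E × E' => christoffel GF x.2) _ (y, z) :=
    HasFDerivAt.comp (y, z) (f := Prod.snd) hF.differentiableAt_christoffel.hasFDerivAt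
      hasFDerivAt_snd
  have k6 : HasFDerivAt (fun x : E × E' => fderiv ℝ φ x.1) _ (y, z) :=
    HasFDerivAt.comp (y, z) (f := Prod.fst)
      ((hφ.fderiv_right (m := 1) (by norm_num)).differentiableAt (by simp)).hasFDerivAt
      hasFDerivAt_fst
  have h := (k1.sub (((k2.const_mul (2 * (1 - μ))).exp.mul
    ((k3.clm_apply (hasFDerivAt_const u.2 _)).clm_apply (hasFDerivAt_const v.2 _))).smul
      k4)).prodMk
    ((((k5.clm_apply (hasFDerivAt_const u.2 _)).clm_apply (hasFDerivAt_const v.2 _)).add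
      ((k6.clm_apply (hasFDerivAt_const u.1 _)).smul (hasFDerivAt_const v.2 _))).add
      ((k6.clm_apply (hasFDerivAt_const v.1 _)).smul (hasFDerivAt_const u.2 _)))
  refine (congrArg (fun l => l w) h.fderiv).trans ?_
  refine Prod.ext ?_ ?_
  · simp [hL']
    module
  · simp

/-- The covariant derivative `∇_u ∇f` of the gradient, that is the Hessian with an index raised. -/
def hessianEnd (G : E → E →L[ℝ] E →L[ℝ] ℝ) (f : E → ℝ) (y : E) : E →L[ℝ] E :=
  (sharp G y).comp (hessian G f y)

theorem riemann_warped_fst_fst (hB : IsMetricAt GB y) (hF : IsMetricAt GF z)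
    (hφ : ContDiffAt ℝ 2 φ y) (u v w : E) :
    (riemann (warped GB GF μ φ) (y, z) (u, 0) (w, 0) (v, 0)).1 = riemann GB y u w v +
      μ • (hessian GB φ y u v • w - hessian GB φ y w v • u - GB y w v • hessianEnd GB φ y u +
        GB y u v • hessianEnd GB φ y w) +
      μ ^ 2 • ((fderiv ℝ φ y w * fderiv ℝ φ y v -
          GB y w v * fderiv ℝ φ y (gradient GB φ y)) • u -
        (fderiv ℝ φ y u * fderiv ℝ φ y v - GB y u v * fderiv ℝ φ y (gradient GB φ y)) • w +
        (fderiv ℝ φ y u * GB y w v - fderiv ℝ φ y w * GB y u v) • gradient GB φ y) := by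
  have hN : ∀ x, GB y x (gradient GB φ y) = fderiv ℝ φ y x := fun x => by
    rw [hB.symm, hB.apply_gradient]
  have hs : fderiv ℝ (fderiv ℝ φ) y w u = fderiv ℝ (fderiv ℝ φ) y u w :=
    hφ.isSymmSndFDerivAt (by simp) w u
  simp only [riemann, fderiv_christoffel_warped hB hF hφ, christoffel_warped hB hF hφ,
    conformalChristoffel, Prod.fst_add, Prod.fst_sub, map_zero, mul_zero, zero_smul,
    smul_zero, sub_zero, add_zero, map_add, map_sub, map_smul, smul_eq_mul, hN,
    hB.fderiv_gradient hφ, hB.fderiv_apply, hessianEnd, ContinuousLinearMap.comp_apply,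
    IsMetricAt.hessian_apply]
  rw [hs, hB.christoffel_symm w u, hB.symm w u, hB.symm (christoffel GB y u w) v,
    hB.symm (christoffel GB y u v) w, hB.symm (christoffel GB y w v) u]
  module

theorem riemann_warped_snd_fst (hB : IsMetricAt GB y) (hF : IsMetricAt GF z)
    (hφ : ContDiffAt ℝ 2 φ y) (u : E') (v w : E) :
    (riemann (warped GB GF μ φ) (y, z) (0, u) (w, 0) (v, 0)).2 =
      (-hessian GB φ y w v + μ * (2 * fderiv ℝ φ y w * fderiv ℝ φ y v -
          GB y w v * fderiv ℝ φ y (gradient GB φ y)) -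
        fderiv ℝ φ y w * fderiv ℝ φ y v) • u := by
  simp only [riemann, fderiv_christoffel_warped hB hF hφ, christoffel_warped hB hF hφ,
    conformalChristoffel, Prod.snd_add, Prod.snd_sub, map_zero, zero_apply, mul_zero, zero_smul,
    smul_zero, sub_zero, add_zero, zero_add, map_add, map_sub, map_smul, smul_eq_mul,
    IsMetricAt.hessian_apply]
  module

theorem riemann_warped_fst_snd (hB : IsMetricAt GB y) (hF : IsMetricAt GF z)
    (hφ : ContDiffAt ℝ 2 φ y) (u : E) (v w : E') :
    (riemann (warped GB GF μ φ) (y, z) (u, 0) (0, w) (0, v)).1 =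
      -(Real.exp (2 * (1 - μ) * φ y) * GF z w v) •
        (hessianEnd GB φ y u + ((1 - 2 * μ) * fderiv ℝ φ y u) • gradient GB φ y +
          (μ * fderiv ℝ φ y (gradient GB φ y)) • u) := by
  have hN : ∀ x, GB y x (gradient GB φ y) = fderiv ℝ φ y x := fun x => by
    rw [hB.symm, hB.apply_gradient]
  simp only [riemann, fderiv_christoffel_warped hB hF hφ, christoffel_warped hB hF hφ,
    conformalChristoffel, Prod.fst_add, Prod.fst_sub, map_zero, zero_apply, mul_zero, zero_smul,
    smul_zero, sub_zero, add_zero, zero_add, map_neg, map_smul, smul_eq_mul, hN,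
    hB.fderiv_gradient hφ, hessianEnd, ContinuousLinearMap.comp_apply, zero_sub]
  module

theorem riemann_warped_snd_snd (hB : IsMetricAt GB y) (hF : IsMetricAt GF z)
    (hφ : ContDiffAt ℝ 2 φ y) (u v w : E') :
    (riemann (warped GB GF μ φ) (y, z) (0, u) (0, w) (0, v)).2 = riemann GF z u w v -
      (Real.exp (2 * (1 - μ) * φ y) * fderiv ℝ φ y (gradient GB φ y)) •
        (GF z w v • u - GF z u v • w) := by
  simp only [riemann, fderiv_christoffel_warped hB hF hφ, christoffel_warped hB hF hφ,
    conformalChristoffel, Prod.snd_add, Prod.snd_sub, map_zero, zero_apply, mul_zero, zero_smul,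
    smul_zero, sub_zero, add_zero, map_neg, map_smul, smul_eq_mul,
    zero_sub]
  module

end WarpedCurvature

section WarpedScalar

theorem trace_prod {V V' : Type*} [AddCommGroup V] [Module ℝ V]
    [AddCommGroup V'] [Module ℝ V'] [FiniteDimensional ℝ V] [FiniteDimensional ℝ V']
    (A : V × V' →ₗ[ℝ] V × V') :
    LinearMap.trace ℝ (V × V') A =
      LinearMap.trace ℝ V (LinearMap.fst ℝ V V' ∘ₗ A ∘ₗ LinearMap.inl ℝ V V') +
      LinearMap.trace ℝ V' (LinearMap.snd ℝ V V' ∘ₗ A ∘ₗ LinearMap.inr ℝ V V') := by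
  have h : A = LinearMap.inl ℝ V V' ∘ₗ (LinearMap.fst ℝ V V' ∘ₗ A) +
      LinearMap.inr ℝ V V' ∘ₗ (LinearMap.snd ℝ V V' ∘ₗ A) := by
    ext v <;> simp
  conv_lhs => rw [h, map_add, LinearMap.trace_comp_comm', LinearMap.trace_comp_comm' _
    (LinearMap.inr ℝ V V')]
  rfl

variable {E : Type*} [NormedAddCommGroup E] [NormedSpace ℝ E]

theorem trace_hessianEnd (G : E → E →L[ℝ] E →L[ℝ] ℝ) (f : E → ℝ) (y : E) :
    LinearMap.trace ℝ E (hessianEnd G f y).toLinearMap = laplacian G f y := rfl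

theorem ricci_apply (G : E → E →L[ℝ] E →L[ℝ] ℝ) (y v w : E) :
    ricci G y v w = LinearMap.trace ℝ E (riemannEnd G y v w) := rfl

variable [FiniteDimensional ℝ E]
  {E' : Type*} [NormedAddCommGroup E'] [NormedSpace ℝ E'] [FiniteDimensional ℝ E']
  {GB : E → E →L[ℝ] E →L[ℝ] ℝ} {GF : E' → E' →L[ℝ] E' →L[ℝ] ℝ} {μ : ℝ} {φ : E → ℝ}
  {y : E} {z : E'}

theorem ricci_warped_fst (hB : IsMetricAt GB y) (hF : IsMetricAt GF z)
    (hφ : ContDiffAt ℝ 2 φ y) (v w : E) :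
    ricci (warped GB GF μ φ) (y, z) (v, 0) (w, 0) = ricci GB y v w -
      (μ * (Module.finrank ℝ E - 2) + Module.finrank ℝ E') * hessian GB φ y v w +
      (μ ^ 2 * (Module.finrank ℝ E - 2) + (2 * μ - 1) * Module.finrank ℝ E') *
        (fderiv ℝ φ y v * fderiv ℝ φ y w) -
      (μ * laplacian GB φ y + (μ ^ 2 * (Module.finrank ℝ E - 2) + μ * Module.finrank ℝ E') *
        fderiv ℝ φ y (gradient GB φ y)) * GB y v w := by
  have := FiniteDimensional.complete ℝ E
  have := FiniteDimensional.complete ℝ E'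
  have hN : ∀ x, GB y x (gradient GB φ y) = fderiv ℝ φ y x := fun x => by
    rw [hB.symm, hB.apply_gradient]
  have h1 : LinearMap.fst ℝ E E' ∘ₗ riemannEnd (warped GB GF μ φ) (y, z) (v, 0) (w, 0) ∘ₗ
      LinearMap.inl ℝ E E' = riemannEnd GB y v w +
      μ • ((hessian GB φ y v).toLinearMap.smulRight w - hessian GB φ y w v • LinearMap.id -
        GB y w v • (hessianEnd GB φ y).toLinearMap +
        (GB y v).toLinearMap.smulRight (hessianEnd GB φ y w)) +
      μ ^ 2 • ((fderiv ℝ φ y w * fderiv ℝ φ y v -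
          GB y w v * fderiv ℝ φ y (gradient GB φ y)) • LinearMap.id -
        (fderiv ℝ φ y v • (fderiv ℝ φ y).toLinearMap -
          fderiv ℝ φ y (gradient GB φ y) • (GB y v).toLinearMap).smulRight w +
        (GB y w v • (fderiv ℝ φ y).toLinearMap -
          fderiv ℝ φ y w • (GB y v).toLinearMap).smulRight (gradient GB φ y)) := by
    ext u
    simp [riemannEnd, riemann_warped_fst_fst hB hF hφ, hB.symm u v, hB.hessian_symm hφ u v]
    module
  have h2 : LinearMap.snd ℝ E E' ∘ₗ riemannEnd (warped GB GF μ φ) (y, z) (v, 0) (w, 0) ∘ₗ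
      LinearMap.inr ℝ E E' = (-hessian GB φ y w v + μ * (2 * fderiv ℝ φ y w * fderiv ℝ φ y v -
          GB y w v * fderiv ℝ φ y (gradient GB φ y)) -
        fderiv ℝ φ y w * fderiv ℝ φ y v) • LinearMap.id := by
    ext u
    simp [riemannEnd, riemann_warped_snd_fst hB hF hφ]
  rw [ricci_apply, trace_prod, h1, h2]
  have e : GB y v (hessianEnd GB φ y w) = hessian GB φ y v w := by
    rw [hB.symm, hessianEnd, ContinuousLinearMap.comp_apply, hB.apply_sharp,
      hB.hessian_symm hφ]
  simp only [map_add, map_sub, map_smul, LinearMap.trace_smulRight, LinearMap.trace_id,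
    trace_hessianEnd,
    ← ricci_apply, ContinuousLinearMap.coe_coe, e, hN, smul_eq_mul, LinearMap.sub_apply,
    LinearMap.smul_apply]
  rw [hB.symm w v, hB.hessian_symm hφ w v]
  ring

theorem ricci_warped_snd (hB : IsMetricAt GB y) (hF : IsMetricAt GF z)
    (hφ : ContDiffAt ℝ 2 φ y) (v w : E') :
    ricci (warped GB GF μ φ) (y, z) (0, v) (0, w) = ricci GF z v w -
      Real.exp (2 * (1 - μ) * φ y) * (laplacian GB φ y + (Module.finrank ℝ E' +
        μ * (Module.finrank ℝ E - 2)) * fderiv ℝ φ y (gradient GB φ y)) * GF z v w := by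
  have := FiniteDimensional.complete ℝ E
  have := FiniteDimensional.complete ℝ E'
  have h1 : LinearMap.fst ℝ E E' ∘ₗ riemannEnd (warped GB GF μ φ) (y, z) (0, v) (0, w) ∘ₗ
      LinearMap.inl ℝ E E' = -(Real.exp (2 * (1 - μ) * φ y) * GF z w v) •
        ((hessianEnd GB φ y).toLinearMap +
          (1 - 2 * μ) • (fderiv ℝ φ y).toLinearMap.smulRight (gradient GB φ y) +
          (μ * fderiv ℝ φ y (gradient GB φ y)) • LinearMap.id) := by
    ext u
    simp [riemannEnd, riemann_warped_fst_snd hB hF hφ]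
    module
  have h2 : LinearMap.snd ℝ E E' ∘ₗ riemannEnd (warped GB GF μ φ) (y, z) (0, v) (0, w) ∘ₗ
      LinearMap.inr ℝ E E' = riemannEnd GF z v w -
      (Real.exp (2 * (1 - μ) * φ y) * fderiv ℝ φ y (gradient GB φ y)) •
        (GF z w v • LinearMap.id - (GF z v).toLinearMap.smulRight w) := by
    ext u
    simp [riemannEnd, riemann_warped_snd_snd hB hF hφ, hF.symm u v]
  rw [ricci_apply, trace_prod, h1, h2]
  simp only [map_add, map_sub, map_smul, LinearMap.trace_smulRight, LinearMap.trace_id,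
    trace_hessianEnd,
    ← ricci_apply, ContinuousLinearMap.coe_coe, smul_eq_mul]
  rw [hF.symm w v]
  ring

theorem scalar_warped (hB : IsMetricAt GB y) (hF : IsMetricAt GF z) (hφ : ContDiffAt ℝ 2 φ y) :
    Real.exp (2 * μ * φ y) * scalar (warped GB GF μ φ) (y, z) = scalar GB y +
      Real.exp (2 * (μ - 1) * φ y) * scalar GF z -
      2 * ((Module.finrank ℝ E - 1) * μ + Module.finrank ℝ E') * laplacian GB φ y -
      ((Module.finrank ℝ E - 1) * (Module.finrank ℝ E - 2) * μ ^ 2 +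
        2 * (Module.finrank ℝ E - 2) * Module.finrank ℝ E' * μ +
        Module.finrank ℝ E' * (Module.finrank ℝ E' + 1)) *
          fderiv ℝ φ y (gradient GB φ y) := by
  have h1 : LinearMap.fst ℝ E E' ∘ₗ ((sharp (warped GB GF μ φ) (y, z)).toLinearMap ∘ₗ
      LinearMap.toContinuousLinearMap.toLinearMap ∘ₗ ricci (warped GB GF μ φ) (y, z)) ∘ₗ
      LinearMap.inl ℝ E E' = Real.exp (-(2 * μ * φ y)) • ((sharp GB y).toLinearMap ∘ₗ
        LinearMap.toContinuousLinearMap.toLinearMap ∘ₗ ricci GB y -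
      (μ * (Module.finrank ℝ E - 2) + Module.finrank ℝ E') • (hessianEnd GB φ y).toLinearMap +
      (μ ^ 2 * (Module.finrank ℝ E - 2) + (2 * μ - 1) * Module.finrank ℝ E') •
        (fderiv ℝ φ y).toLinearMap.smulRight (gradient GB φ y) -
      (μ * laplacian GB φ y + (μ ^ 2 * (Module.finrank ℝ E - 2) + μ * Module.finrank ℝ E') *
        fderiv ℝ φ y (gradient GB φ y)) • LinearMap.id) := by
    ext v
    have e : (LinearMap.toContinuousLinearMap
        (ricci (warped GB GF μ φ) (y, z) (v, 0))).comp (ContinuousLinearMap.inl ℝ E E') =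
        LinearMap.toContinuousLinearMap (ricci GB y v) -
        (μ * (Module.finrank ℝ E - 2) + Module.finrank ℝ E') • hessian GB φ y v +
        ((μ ^ 2 * (Module.finrank ℝ E - 2) + (2 * μ - 1) * Module.finrank ℝ E') *
          fderiv ℝ φ y v) • fderiv ℝ φ y -
        (μ * laplacian GB φ y + (μ ^ 2 * (Module.finrank ℝ E - 2) + μ * Module.finrank ℝ E') *
          fderiv ℝ φ y (gradient GB φ y)) • GB y v := by
      ext w
      simp [ricci_warped_fst hB hF hφ]
      ring
    simp [sharp_warped hB hF hφ, e, hB.sharp_apply, hessianEnd, gradient, smul_smul]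
  have h2 : LinearMap.snd ℝ E E' ∘ₗ ((sharp (warped GB GF μ φ) (y, z)).toLinearMap ∘ₗ
      LinearMap.toContinuousLinearMap.toLinearMap ∘ₗ ricci (warped GB GF μ φ) (y, z)) ∘ₗ
      LinearMap.inr ℝ E E' = Real.exp (-(2 * φ y)) • ((sharp GF z).toLinearMap ∘ₗ
        LinearMap.toContinuousLinearMap.toLinearMap ∘ₗ ricci GF z -
      (Real.exp (2 * (1 - μ) * φ y) * (laplacian GB φ y + (Module.finrank ℝ E' +
        μ * (Module.finrank ℝ E - 2)) * fderiv ℝ φ y (gradient GB φ y))) • LinearMap.id) := by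
    ext v
    have e : (LinearMap.toContinuousLinearMap
        (ricci (warped GB GF μ φ) (y, z) (0, v))).comp (ContinuousLinearMap.inr ℝ E E') =
        LinearMap.toContinuousLinearMap (ricci GF z v) -
        (Real.exp (2 * (1 - μ) * φ y) * (laplacian GB φ y + (Module.finrank ℝ E' +
          μ * (Module.finrank ℝ E - 2)) * fderiv ℝ φ y (gradient GB φ y))) • GF z v := by
      ext w
      simp [ricci_warped_snd hB hF hφ]
    simp [sharp_warped hB hF hφ, e, hF.sharp_apply]
  have e1 : Real.exp (2 * μ * φ y) * Real.exp (-(2 * μ * φ y)) = 1 := by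
    rw [← Real.exp_add]; simp
  have e2 : Real.exp (2 * μ * φ y) * Real.exp (-(2 * φ y)) =
      Real.exp (2 * (μ - 1) * φ y) := by
    rw [← Real.exp_add]; ring_nf
  have e3 : Real.exp (2 * (μ - 1) * φ y) * Real.exp (2 * (1 - μ) * φ y) = 1 := by
    rw [← Real.exp_add]; ring_nf; simp
  rw [scalar, trace_prod, h1, h2]
  simp only [map_add, map_sub, map_smul, LinearMap.trace_smulRight, LinearMap.trace_id,
    trace_hessianEnd,
    ContinuousLinearMap.coe_coe, smul_eq_mul]
  rw [scalar, scalar]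
  generalize LinearMap.trace ℝ E _ = SB
  generalize LinearMap.trace ℝ E' _ = SF
  generalize laplacian GB φ y = L
  generalize fderiv ℝ φ y (gradient GB φ y) = Q
  generalize (Module.finrank ℝ E : ℝ) = m
  generalize (Module.finrank ℝ E' : ℝ) = k
  linear_combination (SB - (μ * (m - 2) + k) * L + (μ ^ 2 * (m - 2) + (2 * μ - 1) * k) * Q -
    (μ * L + (μ ^ 2 * (m - 2) + μ * k) * Q) * m) * e1 + (SF - Real.exp (2 * (1 - μ) * φ y) *
    (L + (k + μ * (m - 2)) * Q) * k) * e2 - (L + (k + μ * (m - 2)) * Q) * k * e3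

end WarpedScalar

section Exp

variable {E : Type*} [NormedAddCommGroup E] [NormedSpace ℝ E]
  {G : E → E →L[ℝ] E →L[ℝ] ℝ} {φ : E → ℝ} {y : E}

theorem fderiv_exp_const_mul (hφ : DifferentiableAt ℝ φ y) (c : ℝ) :
    fderiv ℝ (fun x => Real.exp (c * φ x)) y = (Real.exp (c * φ y) * c) • fderiv ℝ φ y := by
  rw [(hφ.hasFDerivAt.const_mul c).exp.fderiv, smul_smul]

theorem laplacian_exp_const_mul [FiniteDimensional ℝ E] (hφ : ContDiffAt ℝ 2 φ y) (c : ℝ) :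
    laplacian G (fun x => Real.exp (c * φ x)) y =
      c * Real.exp (c * φ y) * (laplacian G φ y + c * fderiv ℝ φ y (gradient G φ y)) := by
  have h1 : fderiv ℝ (fun x => Real.exp (c * φ x)) =ᶠ[𝓝 y]
      fun x => (Real.exp (c * φ x) * c) • fderiv ℝ φ x := by
    filter_upwards [hφ.eventually (by simp)] with x hx
    exact fderiv_exp_const_mul (hx.differentiableAt (by simp)) c
  have h2 : HasFDerivAt (fderiv ℝ φ) _ y :=
    ((hφ.fderiv_right (m := 1) (by norm_num)).differentiableAt (by simp)).hasFDerivAt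
  have h3 := (((hφ.differentiableAt (by simp)).hasFDerivAt.const_mul c).exp.mul_const c).smul h2
  have h4 : hessianEnd G (fun x => Real.exp (c * φ x)) y = (c * Real.exp (c * φ y)) •
      (hessianEnd G φ y + c • (fderiv ℝ φ y).smulRight (gradient G φ y)) := by
    ext u
    have e : hessian G (fun x => Real.exp (c * φ x)) y u = (c * Real.exp (c * φ y)) •
        (hessian G φ y u + (c * fderiv ℝ φ y u) • fderiv ℝ φ y) := by
      ext v
      rw [IsMetricAt.hessian_apply, h1.fderiv_eq, h1.eq_of_nhds]
      refine (congrArg (fun l => l u v - _) h3.fderiv).trans ?_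
      simp [IsMetricAt.hessian_apply]
      ring
    simp [hessianEnd, e, gradient, smul_smul, mul_assoc]
  rw [← trace_hessianEnd, h4, ← trace_hessianEnd]
  simp [mul_add]

end Exp

end MetricInCoordinates

open MetricInCoordinates

theorem ContinuousLinearMap.isInvertible_of_nondegenerate {V : Type*} [NormedAddCommGroup V]
    [NormedSpace ℝ V] [FiniteDimensional ℝ V] (b : V →L[ℝ] V →L[ℝ] ℝ)
    (h : ∀ v, (∀ w, b v w = 0) → v = 0) : b.IsInvertible := by
  have hinj : Function.Injective b.toLinearMap := by
    rw [injective_iff_map_eq_zero]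
    exact fun v hv => h v fun w => congrArg (fun l : V →L[ℝ] ℝ => l w) hv
  have hrank : Module.finrank ℝ V = Module.finrank ℝ (V →L[ℝ] ℝ) := by
    rw [← (LinearMap.toContinuousLinearMap (𝕜 := ℝ) (E := V) (F' := ℝ)).finrank_eq]
    exact (Subspace.dual_finrank_eq (K := ℝ) (V := V)).symm
  exact ⟨(LinearEquiv.ofInjectiveOfFinrankEq b.toLinearMap hinj hrank).toContinuousLinearEquiv,
    by ext; rfl⟩

section Charts

variable {E : Type*} [NormedAddCommGroup E] [NormedSpace ℝ E]
  {H : Type*} [TopologicalSpace H] {I : ModelWithCorners ℝ E H}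
  {M : Type*} [TopologicalSpace M] [ChartedSpace H M]

theorem contDiffAt_comp_extChartAt_symm [I.Boundaryless] {V : Type*}
    [NormedAddCommGroup V] [NormedSpace ℝ V]
    {f : M → V} {x : M} (hf : ContMDiffAt I 𝓘(ℝ, V) ∞ f x) :
    ContDiffAt ℝ ∞ (f ∘ (extChartAt I x).symm) (extChartAt I x x) := by
  have h := (contMDiffAt_iff.1 hf).2
  rw [I.range_eq_univ, contDiffWithinAt_univ] at h
  exact h

theorem contDiffAt_two_comp_extChartAt_symm [I.Boundaryless] {f : M → ℝ}
    (hf : ContMDiff I 𝓘(ℝ, ℝ) ∞ f) (x : M) :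
    ContDiffAt ℝ 2 (f ∘ (extChartAt I x).symm) (extChartAt I x x) :=
  (contDiffAt_comp_extChartAt_symm (hf x)).of_le (by norm_cast)

theorem contMDiff_log_comp {ψ : M → ℝ} (hψ : ContMDiff I 𝓘(ℝ, ℝ) ∞ ψ) (hpos : ∀ b, 0 < ψ b) :
    ContMDiff I 𝓘(ℝ, ℝ) ∞ (fun b => Real.log (ψ b)) := fun b =>
  (Real.contDiffAt_log.2 (hpos b).ne').contMDiffAt.comp b (hψ b)

variable [IsManifold I ∞ M]
  {E' : Type*} [NormedAddCommGroup E'] [NormedSpace ℝ E']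
  {H' : Type*} [TopologicalSpace H'] {J : ModelWithCorners ℝ E' H'}
  {N : Type*} [TopologicalSpace N] [ChartedSpace H' N] [IsManifold J ∞ N]

namespace PseudoRiemannianMetric

variable (g : PseudoRiemannianMetric I M)

theorem inChart_apply (x : M) (y v w : E) :
    g.inChart x y v w = g.val ((extChartAt I x).symm y)
      (mfderiv 𝓘(ℝ, E) I (extChartAt I x).symm y v)
      (mfderiv 𝓘(ℝ, E) I (extChartAt I x).symm y w) := rfl

theorem isInvertible_val [FiniteDimensional ℝ E] (x : M) : (g.val x).IsInvertible :=
  ContinuousLinearMap.isInvertible_of_nondegenerate (V := E) (g.val x) (g.nondegenerate x)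

theorem specialBaseConformalWarpedProduct_val_apply (gF : PseudoRiemannianMetric J N) (μ : ℝ)
    (ψ : M → ℝ) (hψ : ContMDiff I 𝓘(ℝ, ℝ) ∞ ψ) (hpos : ∀ b, 0 < ψ b) (p : M × N)
    (v w : TangentSpace (I.prod J) p) :
    (g.specialBaseConformalWarpedProduct gF μ ψ hψ hpos).val p v w =
      ψ p.1 ^ (2 * μ) * g.val p.1 v.1 w.1 + ψ p.1 ^ 2 * gF.val p.2 v.2 w.2 := by
  have h1 : ∀ a : TangentSpace (I.prod J) p, mfderiv (I.prod J) I Prod.fst p a = a.1 := by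
    intro a; rw [mfderiv_fst]; rfl
  have h2 : ∀ a : TangentSpace (I.prod J) p, mfderiv (I.prod J) J Prod.snd p a = a.2 := by
    intro a; rw [mfderiv_snd]; rfl
  rw [← h1 v, ← h1 w, ← h2 v, ← h2 w]
  rfl

end PseudoRiemannianMetric

variable [I.Boundaryless] [J.Boundaryless]

theorem mdifferentiableAt_extChartAt_symm {x : M} {y : E} (hy : y ∈ (extChartAt I x).target) :
    MDifferentiableAt 𝓘(ℝ, E) I (extChartAt I x).symm y := by
  have : IsManifold I 1 M := IsManifold.of_le (n := ∞) (by simp)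
  have h := mdifferentiableWithinAt_extChartAt_symm (I := I) hy
  rwa [I.range_eq_univ, mdifferentiableWithinAt_univ] at h

theorem isInvertible_mfderiv_extChartAt_symm {x : M} {y : E} (hy : y ∈ (extChartAt I x).target) :
    (mfderiv 𝓘(ℝ, E) I (extChartAt I x).symm y).IsInvertible := by
  have : IsManifold I 1 M := IsManifold.of_le (n := ∞) (by simp)
  have h := isInvertible_mfderivWithin_extChartAt_symm (I := I) hy
  rwa [I.range_eq_univ, mfderivWithin_univ] at h

namespace PseudoRiemannianMetric

variable (g : PseudoRiemannianMetric I M)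

theorem isInvertible_inChart [FiniteDimensional ℝ E] {x : M} {y : E}
    (hy : y ∈ (extChartAt I x).target) : (g.inChart x y).IsInvertible := by
  have hA := isInvertible_mfderiv_extChartAt_symm (I := I) hy
  refine ContinuousLinearMap.isInvertible_of_nondegenerate _ fun v hv => hA.injective ?_
  refine Eq.trans ?_ (map_zero (mfderiv 𝓘(ℝ, E) I (extChartAt I x).symm y)).symm
  refine g.nondegenerate _ _ fun w => ?_
  obtain ⟨w, rfl⟩ := hA.surjective w
  exact hv w

theorem contDiffAt_inChart (x : M) : ContDiffAt ℝ ∞ (g.inChart x) (extChartAt I x x) := by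
  have h := contDiffAt_comp_extChartAt_symm ((contMDiffAt_form_iff g.val x).1 (g.contMDiff x))
  refine h.congr_of_eventuallyEq ?_
  filter_upwards [extChartAt_target_mem_nhds (I := I) x] with y hy
  have : IsManifold I 1 M := IsManifold.of_le (n := ∞) (by simp)
  have hs : (extChartAt I x).symm y ∈ (chartAt H x).source := by
    rw [← extChartAt_source (I := I)]; exact (extChartAt I x).map_target hy
  have e := TangentBundle.symmL_trivializationAt (𝕜 := ℝ) (I := I) hs
  rw [(extChartAt I x).right_inv hy, I.range_eq_univ, mfderivWithin_univ] at e
  simp only [Function.comp_apply, inChart]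
  rw [e]

theorem isMetricAt_inChart [FiniteDimensional ℝ E] (x : M) :
    IsMetricAt (g.inChart x) (extChartAt I x x) where
  contDiffAt := (g.contDiffAt_inChart x).of_le (by norm_cast)
  eventually_symm := Filter.Eventually.of_forall fun y v w => by
    rw [inChart_apply, inChart_apply, g.symm]
  eventually_isInvertible := by
    filter_upwards [extChartAt_target_mem_nhds (I := I) x] with y hy using g.isInvertible_inChart hy

theorem normSqGradient_extChartAt_symm [FiniteDimensional ℝ E] {f : M → ℝ} {x : M} {y : E}
    (hy : y ∈ (extChartAt I x).target)
    (hf : MDifferentiableAt I 𝓘(ℝ, ℝ) f ((extChartAt I x).symm y)) :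
    g.normSqGradient f ((extChartAt I x).symm y) =
      fderiv ℝ (f ∘ (extChartAt I x).symm) y
        (MetricInCoordinates.gradient (E := E) (g.inChart x) (f ∘ (extChartAt I x).symm) y) := by
  have hA := isInvertible_mfderiv_extChartAt_symm (I := I) hy
  have hd : ∀ v, fderiv ℝ (f ∘ (extChartAt I x).symm) y v =
      mfderiv I 𝓘(ℝ, ℝ) f ((extChartAt I x).symm y)
        (mfderiv 𝓘(ℝ, E) I (extChartAt I x).symm y v) := by
    intro v
    rw [← mfderiv_eq_fderiv, mfderiv_comp y hf (mdifferentiableAt_extChartAt_symm hy)]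
    rfl
  have hN : g.gradient f ((extChartAt I x).symm y) =
      mfderiv 𝓘(ℝ, E) I (extChartAt I x).symm y
        (MetricInCoordinates.gradient (E := E) (g.inChart x) (f ∘ (extChartAt I x).symm) y) := by
    refine (g.isInvertible_val _).injective ?_
    refine ((g.isInvertible_val _).self_apply_inverse _).trans ?_
    ext w
    obtain ⟨w, rfl⟩ := hA.surjective w
    refine (hd w).symm.trans ?_
    have := congrArg (fun l => l w) ((g.isInvertible_inChart hy).self_apply_inverse
      (fderiv ℝ (f ∘ (extChartAt I x).symm) y))
    exact this.symm
  rw [hd, ← hN]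
  exact congrArg (fun l => l (g.gradient f ((extChartAt I x).symm y)))
    ((g.isInvertible_val _).self_apply_inverse (mfderiv I 𝓘(ℝ, ℝ) f ((extChartAt I x).symm y)))

theorem normSqGradient_eq [FiniteDimensional ℝ E] {f : M → ℝ} {x : M}
    (hf : MDifferentiableAt I 𝓘(ℝ, ℝ) f x) :
    g.normSqGradient f x =
      fderiv ℝ (f ∘ (extChartAt I x).symm) (extChartAt I x x)
        (MetricInCoordinates.gradient (E := E) (g.inChart x) (f ∘ (extChartAt I x).symm)
          (extChartAt I x x)) := by
  have hx := extChartAt_to_inv (I := I) x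
  have h := g.normSqGradient_extChartAt_symm (f := f) (mem_extChartAt_target (I := I) x)
    (by rwa [hx])
  rwa [hx] at h

theorem inChart_specialBaseConformalWarpedProduct (gF : PseudoRiemannianMetric J N) (μ : ℝ)
    (ψ : M → ℝ) (hψ : ContMDiff I 𝓘(ℝ, ℝ) ∞ ψ) (hpos : ∀ b, 0 < ψ b) (p : M × N) :
    (g.specialBaseConformalWarpedProduct gF μ ψ hψ hpos).inChart p
      =ᶠ[𝓝 (extChartAt I p.1 p.1, extChartAt J p.2 p.2)]
    warped (g.inChart p.1) (gF.inChart p.2) μ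
      (fun y => Real.log (ψ ((extChartAt I p.1).symm y))) := by
  filter_upwards [continuousAt_fst.eventually (extChartAt_target_mem_nhds (I := I) p.1),
    continuousAt_snd.eventually (extChartAt_target_mem_nhds (I := J) p.2)] with x h1 h2
  have e : ((extChartAt (I.prod J) p).symm : E × E' → M × N) =
      Prod.map (extChartAt I p.1).symm (extChartAt J p.2).symm := by
    rw [extChartAt_prod]; rfl
  have hd : mfderiv 𝓘(ℝ, E × E') (I.prod J) (extChartAt (I.prod J) p).symm x =
      (mfderiv 𝓘(ℝ, E) I (extChartAt I p.1).symm x.1).prodMap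
        (mfderiv 𝓘(ℝ, E') J (extChartAt J p.2).symm x.2) := by
    rw [e, modelWithCornersSelf_prod, ← chartedSpaceSelf_prod]
    exact mfderiv_prodMap (mdifferentiableAt_extChartAt_symm h1)
      (mdifferentiableAt_extChartAt_symm h2)
  refine ContinuousLinearMap.ext fun v => ContinuousLinearMap.ext fun w => ?_
  have hD : ∀ v : E × E', mfderiv 𝓘(ℝ, E × E') (I.prod J) (extChartAt (I.prod J) p).symm x v =
      (mfderiv 𝓘(ℝ, E) I (extChartAt I p.1).symm x.1 v.1,
        mfderiv 𝓘(ℝ, E') J (extChartAt J p.2).symm x.2 v.2) := by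
    intro v; rw [hd]; rfl
  have hp : 0 < ψ ((extChartAt I p.1).symm x.1) := hpos _
  rw [warped_apply, mul_comm (2 * μ), ← Real.rpow_def_of_pos hp, mul_comm 2 (Real.log _),
    ← Real.rpow_def_of_pos hp, Real.rpow_two]
  refine (g.specialBaseConformalWarpedProduct_val_apply gF μ ψ hψ hpos _ _ _).trans ?_
  exact congrArg₂ (fun a b : E × E' => ψ ((extChartAt I p.1).symm x.1) ^ (2 * μ) *
    g.val ((extChartAt I p.1).symm x.1) a.1 b.1 + ψ ((extChartAt I p.1).symm x.1) ^ 2 *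
    gF.val ((extChartAt J p.2).symm x.2) a.2 b.2) (hD v) (hD w)

end PseudoRiemannianMetric

end Charts

namespace PseudoRiemannianMetric

variable {E : Type*} [NormedAddCommGroup E] [NormedSpace ℝ E] [FiniteDimensional ℝ E]
  {H : Type*} [TopologicalSpace H] {I : ModelWithCorners ℝ E H} [I.Boundaryless]
  {M : Type*} [TopologicalSpace M] [ChartedSpace H M] [IsManifold I ∞ M]
  {E' : Type*} [NormedAddCommGroup E'] [NormedSpace ℝ E'] [FiniteDimensional ℝ E']
  {H' : Type*} [TopologicalSpace H'] {J : ModelWithCorners ℝ E' H'} [J.Boundaryless]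
  {N : Type*} [TopologicalSpace N] [ChartedSpace H' N] [IsManifold J ∞ N]
  (gB : PseudoRiemannianMetric I M) (gF : PseudoRiemannianMetric J N)

/-- The scalar curvature of `ψ^(2μ) g_B + ψ² g_F`, in terms of `log ψ`. -/
theorem scalarCurvature_specialBaseConformalWarpedProduct (μ : ℝ) (ψ : M → ℝ)
    (hψ : ContMDiff I 𝓘(ℝ, ℝ) ∞ ψ) (hpos : ∀ b, 0 < ψ b) (b : M) (f : N) :
    ψ b ^ (2 * μ) *
        (gB.specialBaseConformalWarpedProduct gF μ ψ hψ hpos).scalarCurvature (b, f) =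
      gB.scalarCurvature b + ψ b ^ (2 * (μ - 1)) * gF.scalarCurvature f -
      2 * ((Module.finrank ℝ E - 1) * μ + Module.finrank ℝ E') *
        gB.laplacian (fun x => Real.log (ψ x)) b -
      ((Module.finrank ℝ E - 1) * (Module.finrank ℝ E - 2) * μ ^ 2 +
        2 * (Module.finrank ℝ E - 2) * Module.finrank ℝ E' * μ +
        Module.finrank ℝ E' * (Module.finrank ℝ E' + 1)) *
        gB.normSqGradient (fun x => Real.log (ψ x)) b := by
  have hlog := contMDiff_log_comp hψ hpos
  have h := scalar_warped (μ := μ) (gB.isMetricAt_inChart b) (gF.isMetricAt_inChart f)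
    (contDiffAt_two_comp_extChartAt_symm hlog b)
  rw [← gB.normSqGradient_eq ((hlog b).mdifferentiableAt (by simp))] at h
  have hx : ((fun x => Real.log (ψ x)) ∘ (extChartAt I b).symm) (extChartAt I b b) =
      Real.log (ψ b) := by
    simp only [Function.comp_apply, extChartAt_to_inv]
  rw [hx, mul_comm (2 * μ), mul_comm (2 * (μ - 1)), ← Real.rpow_def_of_pos (hpos b),
    ← Real.rpow_def_of_pos (hpos b)] at h
  have hs : (gB.specialBaseConformalWarpedProduct gF μ ψ hψ hpos).scalarCurvature (b, f) =
      scalar (warped (gB.inChart b) (gF.inChart f) μ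
        ((fun x => Real.log (ψ x)) ∘ (extChartAt I b).symm))
        (extChartAt I b b, extChartAt J f f) :=
    scalar_congr (gB.inChart_specialBaseConformalWarpedProduct gF μ ψ hψ hpos (b, f))
  rw [hs]
  exact h

theorem laplacian_exp_const_mul {φ : M → ℝ} (hφ : ContMDiff I 𝓘(ℝ, ℝ) ∞ φ) (c : ℝ) (b : M) :
    gB.laplacian (fun x => Real.exp (c * φ x)) b =
      c * Real.exp (c * φ b) * (gB.laplacian φ b + c * gB.normSqGradient φ b) := by
  have h := MetricInCoordinates.laplacian_exp_const_mul (G := gB.inChart b)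
    (contDiffAt_two_comp_extChartAt_symm hφ b) c
  rw [← gB.normSqGradient_eq ((hφ b).mdifferentiableAt (by simp))] at h
  simp only [Function.comp_apply, extChartAt_to_inv] at h
  exact h

theorem normSqGradient_log {ψ : M → ℝ} (hψ : ContMDiff I 𝓘(ℝ, ℝ) ∞ ψ) (hpos : ∀ b, 0 < ψ b)
    (b : M) :
    gB.normSqGradient (fun x => Real.log (ψ x)) b = gB.normSqGradient ψ b / ψ b ^ 2 := by
  have hlog := contMDiff_log_comp hψ hpos
  have hx : (ψ ∘ (extChartAt I b).symm) (extChartAt I b b) = ψ b := by simp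
  have hd : fderiv ℝ ((fun x => Real.log (ψ x)) ∘ (extChartAt I b).symm) (extChartAt I b b) =
      (ψ b)⁻¹ • fderiv ℝ (ψ ∘ (extChartAt I b).symm) (extChartAt I b b) := by
    have h := ((contDiffAt_two_comp_extChartAt_symm hψ b).differentiableAt
      (by simp)).hasFDerivAt.log
      (by rw [hx]; exact (hpos b).ne')
    rw [hx] at h
    exact h.fderiv
  rw [gB.normSqGradient_eq ((hlog b).mdifferentiableAt (by simp)),
    gB.normSqGradient_eq ((hψ b).mdifferentiableAt (by simp)), MetricInCoordinates.gradient, hd,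
    map_smul, smul_apply, map_smul, smul_eq_mul, smul_eq_mul, MetricInCoordinates.gradient]
  field_simp

end PseudoRiemannianMetric

end

theorem mainTheorem1 (m k : ℕ) (hm : 2 ≤ m)
    {B : Type*} [TopologicalSpace B] [ChartedSpace (EuclideanSpace ℝ (Fin m)) B]
    [IsManifold (𝓡 m) ∞ B]
    {F : Type*} [TopologicalSpace F] [ChartedSpace (EuclideanSpace ℝ (Fin k)) F]
    [IsManifold (𝓡 k) ∞ F]
    (gB : PseudoRiemannianMetric (𝓡 m) B) (gF : PseudoRiemannianMetric (𝓡 k) F)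
    (μ : ℝ) (ψ : B → ℝ) (hψ : ContMDiff (𝓡 m) 𝓘(ℝ, ℝ) ∞ ψ) (hpos : ∀ b, 0 < ψ b) :
    let g := gB.specialBaseConformalWarpedProduct gF μ ψ hψ hpos
    (μ ≠ -(k : ℝ) / ((m : ℝ) - 1) → ¬ (m = 2 ∧ k = 0) →
      let η : ℝ := ((k + (m - 1) * μ) + (1 - μ)) * k + (m - 2) * μ * (k + (m - 1) * μ)
      let α : ℝ := 2 * (k + (m - 1) * μ) / η
      let β : ℝ := α * (2 * (k + (m - 1) * μ))
      η = (m - 1) * (m - 2) * μ ^ 2 + 2 * (m - 2) * k * μ + k * (k + 1) ∧ 0 < η ∧ 0 < β ∧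
      (∃ u : B → ℝ, ContMDiff (𝓡 m) 𝓘(ℝ, ℝ) ∞ u ∧ (∀ b, 0 < u b) ∧ ∀ b, ψ b = u b ^ α) ∧
      ∀ u : B → ℝ, (∀ b, 0 < u b) → (∀ b, ψ b = u b ^ α) → ∀ (b : B) (f : F),
        -β * gB.laplacian u b + gB.scalarCurvature b * u b =
          g.scalarCurvature (b, f) * u b ^ (2 * μ * α + 1)
            - gF.scalarCurvature f * u b ^ (2 * (μ - 1) * α + 1)) ∧
    (μ = -(k : ℝ) / ((m : ℝ) - 1) → ∀ (b : B) (f : F),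
      -(-(k : ℝ) ^ 2 * ((m - 2) / (m - 1)) + k * (k + 1)) * (gB.normSqGradient ψ b / ψ b ^ 2) =
        ψ b ^ (-2 * ((k : ℝ) / (m - 1))) * g.scalarCurvature (b, f)
          - gB.scalarCurvature b
          - gF.scalarCurvature f * ψ b ^ (-2 * ((k : ℝ) / (m - 1) + 1))) := by

  intro g
  have hm' : (2 : ℝ) ≤ m := by exact_mod_cast hm
  have hm1 : (m : ℝ) - 1 ≠ 0 := by linarith
  have hk : (0 : ℝ) ≤ k := k.cast_nonneg
  have hS : ∀ (b : B) (f : F), ψ b ^ (2 * μ) * g.scalarCurvature (b, f) =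
      gB.scalarCurvature b + ψ b ^ (2 * (μ - 1)) * gF.scalarCurvature f -
      2 * ((m - 1) * μ + k) * gB.laplacian (fun x => Real.log (ψ x)) b -
      ((m - 1) * (m - 2) * μ ^ 2 + 2 * (m - 2) * k * μ + k * (k + 1)) *
        gB.normSqGradient (fun x => Real.log (ψ x)) b := by
    intro b f
    have h := gB.scalarCurvature_specialBaseConformalWarpedProduct gF μ ψ hψ hpos b f
    simpa only [finrank_euclideanSpace_fin] using h
  refine ⟨fun hμ hmk => ?_, fun hμ b f => ?_⟩
  · intro η α β
    have hA : (k : ℝ) + (m - 1) * μ ≠ 0 := by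
      intro h
      apply hμ
      field_simp
      linarith
    have hη : η = (m - 1) * (m - 2) * μ ^ 2 + 2 * (m - 2) * k * μ + k * (k + 1) := by
      simp only [η]; ring
    have hη0 : 0 < η := by
      have h1 : (m - 1) * η = (m - 2) * (k + (m - 1) * μ) ^ 2 + k * (k + (m - 1)) := by
        rw [hη]; ring
      have h2 : 0 < (m - 2) * (k + (m - 1) * μ) ^ 2 + k * (k + (m - 1)) := by
        have h3 : 0 ≤ (m - 2) * (k + (m - 1) * μ) ^ 2 :=
          mul_nonneg (by linarith) (sq_nonneg _)
        rcases Nat.eq_zero_or_pos k with hk0 | hk0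
        · have hm2 : (2 : ℝ) < m := by
            exact_mod_cast lt_of_le_of_ne hm fun h => hmk ⟨h.symm, hk0⟩
          have : 0 < (m - 2) * (k + (m - 1) * μ) ^ 2 :=
            mul_pos (by linarith) (sq_pos_of_ne_zero hA)
          have : (0 : ℝ) ≤ k * (k + (m - 1)) := mul_nonneg hk (by linarith)
          linarith
        · have : (0 : ℝ) < k := by exact_mod_cast hk0
          have : (0 : ℝ) < k * (k + (m - 1)) := mul_pos this (by linarith)
          linarith
      rw [← h1] at h2
      exact pos_of_mul_pos_right h2 (by linarith)
    have hα : α ≠ 0 := div_ne_zero (mul_ne_zero two_ne_zero hA) hη0.ne'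
    have hαη : α * η = 2 * (k + (m - 1) * μ) := div_mul_cancel₀ _ hη0.ne'
    have hβ : β = α ^ 2 * η := by
      simp only [β]; rw [← hαη]; ring
    refine ⟨hη, hη0, ?_, ?_, ?_⟩
    · rw [hβ]; positivity
    · refine ⟨fun b => ψ b ^ α⁻¹, fun b => ?_, fun b => Real.rpow_pos_of_pos (hpos b) _,
        fun b => ?_⟩
      · exact (Real.contDiffAt_rpow_const_of_ne (p := α⁻¹) (n := ∞)
          (hpos b).ne').contMDiffAt.comp b (hψ b)
      · rw [← Real.rpow_mul (hpos b).le, inv_mul_cancel₀ hα, Real.rpow_one]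
    · intro u hu huψ b f
      have hlog : ∀ x, u x = Real.exp (α⁻¹ * Real.log (ψ x)) := by
        intro x
        rw [huψ, Real.log_rpow (hu x), inv_mul_cancel_left₀ hα, Real.exp_log (hu x)]
      have hL : gB.laplacian u b = α⁻¹ * u b * (gB.laplacian (fun x => Real.log (ψ x)) b +
          α⁻¹ * gB.normSqGradient (fun x => Real.log (ψ x)) b) := by
        have h := gB.laplacian_exp_const_mul
          (contMDiff_log_comp hψ hpos) α⁻¹ b
        rwa [← hlog, ← funext hlog] at h
      have hP : ∀ c : ℝ, u b ^ (2 * c * α + 1) = ψ b ^ (2 * c) * u b := by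
        intro c
        rw [huψ b, ← Real.rpow_mul (hu b).le, Real.rpow_add (hu b), Real.rpow_one,
          mul_comm (2 * c)]
      rw [hP, hP, hL, hβ]
      have h := hS b f
      rw [← hη, add_comm _ (k : ℝ), ← hαη] at h
      clear_value β α η
      field_simp
      linear_combination -(u b) * h
  · have hA : (m - 1) * μ + (k : ℝ) = 0 := by rw [hμ]; field_simp; ring
    have e1 : -2 * ((k : ℝ) / (m - 1)) = 2 * μ := by rw [hμ]; ring
    have e2 : -2 * ((k : ℝ) / (m - 1) + 1) = 2 * (μ - 1) := by rw [hμ]; ring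
    rw [e1, e2, hS, gB.normSqGradient_log hψ hpos, hA]
    have e3 : ((m : ℝ) - 1) * (m - 2) * μ ^ 2 + 2 * (m - 2) * k * μ + k * (k + 1) =
        -(k : ℝ) ^ 2 * ((m - 2) / (m - 1)) + k * (k + 1) := by
      rw [hμ]; field_simp; ring
    rw [e3]
    ring
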